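/- Let $N\ge 2$, $0<s<1$, and let $\mathbb R^N_+=\{x\in\mathbb R^N : x_N>0\}$. For a function $v$ put $$(-\Delta)^s v(x)=\lim_{\varepsilon\to 0^+}\int_{\mathbb R^N\setminus B_\varepsilon(x)}\frac{v(x)-v(y)}{|x-y|^{N+2s}}\,dy$$ (a positive normalization constant is omitted) whenever these integrals converge absolutely and the limit exists. For an open set $D\subset\mathbb R^N$ and a bounded function $u\in C(\mathbb R^N)$, the inequality $(-\Delta)^s u\ge 0$ in $D$ is said to hold in the viscosity sense if for every $x_0\in D$, every bounded open neighbourhood $U\subset D$ of $x_0$ and every $\varphi\in C^\infty(\mathbb R^N)$ with $\varphi(x_0)=u(x_0)$ and $\varphi<u$ in $U\setminus\{x_0\}$, the function $\psi$ given by $\psi=\varphi$ in $U$ and $\psi=u$ in $\mathbb R^N\setminus U$ satisfies $(-\Delta)^s\psi(x_0)\ge 0$. Let $D\subset\mathbb R^N_+$ be a domain (a nonempty, connected, open set, possibly unbounded), and let $u\in C(\mathbb R^N)$ be a bounded function such that $(-\Delta)^s u\ge 0$ in $D$ in the viscosity sense and $u\ge 0$ in $\mathbb R^N\setminus D$. Then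 $u\ge 0$ in $D$. -/

import Mathlib

open scoped ContDiff

/-- The open half-space `{x ∈ ℝ^N : x_N > 0}`: the last coordinate is positive. -/
def halfSpace (N : ℕ) : Set (EuclideanSpace ℝ (Fin N)) :=
  {x | ∀ i : Fin N, (i : ℕ) + 1 = N → 0 < x i}

/-- `(-Δ)^s v (x)` exists as a principal value and equals `L` (normalization constant omitted):
the integrals of `(v(x) - v(y)) / |x - y|^{N+2s}` over the complements of the balls `B_ε(x)`
converge absolutely, and they tend to `L` as `ε → 0⁺`. -/
def HasFracLaplacianAt {N : ℕ} (s : ℝ) (v : EuclideanSpace ℝ (Fin N) → ℝ)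
    (x : EuclideanSpace ℝ (Fin N)) (L : ℝ) : Prop :=
  (∀ ε : ℝ, 0 < ε → MeasureTheory.IntegrableOn
    (fun y => (v x - v y) / ‖x - y‖ ^ ((N : ℝ) + 2 * s)) (Metric.ball x ε)ᶜ) ∧
  Filter.Tendsto
    (fun ε : ℝ => ∫ y in (Metric.ball x ε)ᶜ, (v x - v y) / ‖x - y‖ ^ ((N : ℝ) + 2 * s))
    (nhdsWithin 0 (Set.Ioi 0)) (nhds L)

open Classical in
/-- `(-Δ)^s u ≥ 0` in `D` in the viscosity sense: whenever `x₀ ∈ D`, `U ⊆ D` is a bounded open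
neighbourhood of `x₀`, and `φ ∈ C^∞(ℝ^N)` touches `u` from below at `x₀`, strictly in
`U \ {x₀}`, the function `ψ` equal to `φ` in `U` and to `u` outside `U` satisfies
`(-Δ)^s ψ (x₀) ≥ 0`. -/
def IsViscositySupersolution {N : ℕ} (s : ℝ) (D : Set (EuclideanSpace ℝ (Fin N)))
    (u : EuclideanSpace ℝ (Fin N) → ℝ) : Prop :=
  ∀ x₀ ∈ D, ∀ U : Set (EuclideanSpace ℝ (Fin N)),
    IsOpen U → x₀ ∈ U → U ⊆ D → Bornology.IsBounded U →
    ∀ φ : EuclideanSpace ℝ (Fin N) → ℝ, ContDiff ℝ ∞ φ →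
      φ x₀ = u x₀ → (∀ y ∈ U, y ≠ x₀ → φ y < u y) →
      ∃ L : ℝ, HasFracLaplacianAt s (U.piecewise φ u) x₀ L ∧ 0 ≤ L

open MeasureTheory Metric Set Filter Topology

/-! If `inf u = -m < 0`, the infimum need not be attained, so take `x₀` with `u x₀ ≤ -m + δm`. Such
a point lies in `D`; let `d > 0` be its last coordinate. A paraboloid of opening of order `δm / d²`
touches `u` from below at some `x₁` within `d` of `x₀` (`exists_touching_paraboloid`). In units of
`d`, the paraboloid contributes at most `4δmk` to the fractional Laplacian at `x₁`, while a fixed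
ball below the half-space, where `u ≥ 0`, contributes at most `-mc`
(`balance_of_touching_paraboloid`). The constants `k`, `c` depend only on `N` and `s`, not on `d`,
so a small `δ` contradicts the supersolution property, even for unbounded `D`. -/

/-- The Lévy kernel `|z|^{-N-2s}` integrates `min(1, |z|²)`. -/
theorem integrable_min_one_sq_div_norm_rpow {N : ℕ} (hN : 1 ≤ N) {s : ℝ} (hs0 : 0 < s)
    (hs1 : s < 1) :
    Integrable (fun z : EuclideanSpace ℝ (Fin N) =>
      min 1 (‖z‖ ^ 2) / ‖z‖ ^ ((N : ℝ) + 2 * s)) := by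
  have : Nonempty (Fin N) := ⟨⟨0, hN⟩⟩
  rw [integrable_fun_norm_addHaar volume
    (f := fun r : ℝ => min 1 (r ^ 2) / r ^ ((N : ℝ) + 2 * s))]
  have hpow : ∀ r : ℝ, 0 < r →
      r ^ (Module.finrank ℝ (EuclideanSpace ℝ (Fin N)) - 1) / r ^ ((N : ℝ) + 2 * s)
        = r ^ (-1 - 2 * s) := by
    intro r hr
    rw [finrank_euclideanSpace_fin, ← Real.rpow_natCast, ← Real.rpow_sub hr, Nat.cast_sub hN]
    congr 1
    push_cast
    ring
  -- In polar coordinates, integrability near `0` needs `s < 1`, and at infinity `s > 0`.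
  rw [← Ioc_union_Ioi_eq_Ioi (zero_le_one (α := ℝ)), integrableOn_union]
  constructor
  · have h := (intervalIntegral.intervalIntegrable_rpow' (a := 0) (b := 1)
      (show -1 < 1 - 2 * s by linarith)).1
    refine h.congr_fun (fun r hr => ?_) measurableSet_Ioc
    have h1 : min 1 (r ^ 2) = r ^ 2 := min_eq_right (by nlinarith [hr.1, hr.2])
    have h2 : r ^ (1 - 2 * s) = r ^ 2 * r ^ (-1 - 2 * s) := by
      rw [← Real.rpow_natCast r 2, ← Real.rpow_add hr.1]
      congr 1
      push_cast
      ring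
    simp only [smul_eq_mul, h1, h2, ← hpow r hr.1]
    ring
  · have h := integrableOn_Ioi_rpow_of_lt (show -1 - 2 * s < -1 by linarith) zero_lt_one
    refine h.congr_fun (fun r hr => ?_) measurableSet_Ioi
    have hr' : 1 < r := hr
    have h1 : min 1 (r ^ 2) = 1 := min_eq_left (by nlinarith)
    simp only [smul_eq_mul, h1, ← hpow r (by linarith)]
    ring

/-- The Lévy kernel is integrable on sets that avoid the unit ball. -/
theorem integrableOn_inv_norm_rpow {N : ℕ} (hN : 1 ≤ N) {s : ℝ} (hs0 : 0 < s) (hs1 : s < 1)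
    {B : Set (EuclideanSpace ℝ (Fin N))} (hB : MeasurableSet B) (hB1 : B ⊆ (ball 0 1)ᶜ) :
    IntegrableOn (fun z => (‖z‖ ^ ((N : ℝ) + 2 * s))⁻¹) B := by
  refine (integrable_min_one_sq_div_norm_rpow hN hs0 hs1).integrableOn.congr_fun
    (fun z hz => ?_) hB
  have h1 : 1 ≤ ‖z‖ := by simpa using hB1 hz
  simp only [min_eq_left (show 1 ≤ ‖z‖ ^ 2 by nlinarith), one_div]

/-- An open ball away from the unit ball has positive Lévy measure. -/
theorem setIntegral_inv_norm_rpow_pos {N : ℕ} (hN : 1 ≤ N) {s : ℝ} (hs0 : 0 < s) (hs1 : s < 1)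
    {c : EuclideanSpace ℝ (Fin N)} {r : ℝ} (hr : 0 < r) (hB1 : ball c r ⊆ (ball 0 1)ᶜ) :
    0 < ∫ z in ball c r, (‖z‖ ^ ((N : ℝ) + 2 * s))⁻¹ := by
  rw [setIntegral_pos_iff_support_of_nonneg_ae
    (Eventually.of_forall fun z => by positivity)
    (integrableOn_inv_norm_rpow hN hs0 hs1 measurableSet_ball hB1)]
  rw [inter_eq_right.2]
  · exact measure_ball_pos volume c hr
  · intro z hz
    have h1 : 1 ≤ ‖z‖ := by simpa using hB1 hz
    exact (inv_pos.2 (Real.rpow_pos_of_pos (by linarith) _)).ne'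

/-! ### Scaling and one-sided bounds for the fractional Laplacian -/

/-- Translation and dilation covariance of the fractional Laplacian. -/
theorem HasFracLaplacianAt.comp_add_smul {N : ℕ} {s : ℝ} {v : EuclideanSpace ℝ (Fin N) → ℝ}
    {x : EuclideanSpace ℝ (Fin N)} {L : ℝ} (h : HasFracLaplacianAt s v x L) {d : ℝ} (hd : 0 < d) :
    HasFracLaplacianAt s (fun z => v (x + d • z)) 0 (d ^ (2 * s) * L) := by
  have key : ∀ (ε : ℝ) (z : EuclideanSpace ℝ (Fin N)),
      (ball (0 : EuclideanSpace ℝ (Fin N)) ε)ᶜ.indicator (fun z => (v (x + d • 0) - v (x + d • z))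
          / ‖0 - z‖ ^ ((N : ℝ) + 2 * s)) z
        = d ^ ((N : ℝ) + 2 * s) * (ball x (d * ε))ᶜ.indicator
          (fun y => (v x - v y) / ‖x - y‖ ^ ((N : ℝ) + 2 * s)) (x + d • z) := by
    intro ε z
    have hmem : x + d • z ∈ (ball x (d * ε))ᶜ ↔ z ∈ (ball 0 ε)ᶜ := by
      simp [norm_smul, abs_of_pos hd, mul_le_mul_iff_right₀ hd]
    by_cases hz : z ∈ (ball 0 ε)ᶜ
    · rw [indicator_of_mem hz, indicator_of_mem (hmem.2 hz)]
      have h1 : ‖x - (x + d • z)‖ = d * ‖z‖ := by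
        rw [sub_add_cancel_left, norm_neg, norm_smul, Real.norm_of_nonneg hd.le]
      have h2 : d ^ ((N : ℝ) + 2 * s) ≠ 0 := (Real.rpow_pos_of_pos hd _).ne'
      rw [h1, Real.mul_rpow hd.le (norm_nonneg z), zero_sub, norm_neg, smul_zero, add_zero]
      rw [mul_div_assoc', mul_div_mul_left _ _ h2]
    · rw [indicator_of_notMem hz, indicator_of_notMem (fun h => hz (hmem.1 h)), mul_zero]
  have key' := fun ε => funext (key ε)
  refine ⟨fun ε hε => ?_, ?_⟩
  · rw [← integrable_indicator_iff measurableSet_ball.compl, key' ε]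
    refine Integrable.const_mul ?_ _
    have h1 := (integrable_indicator_iff measurableSet_ball.compl).2 (h.1 (d * ε) (by positivity))
    have h2 := h1.comp_add_left x
    exact (integrable_comp_smul_iff volume _ hd.ne').2 h2
  · have hlim : Tendsto (fun ε : ℝ => d * ε) (𝓝[>] 0) (𝓝[>] 0) := by
      refine tendsto_nhdsWithin_iff.2 ⟨?_, ?_⟩
      · have : Tendsto (fun ε : ℝ => d * ε) (𝓝 0) (𝓝 (d * 0)) :=
          (continuous_const.mul continuous_id).tendsto 0
        rw [mul_zero] at this
        exact this.mono_left nhdsWithin_le_nhds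
      · filter_upwards [self_mem_nhdsWithin] with ε hε
        exact mul_pos hd hε
    refine ((h.2.comp hlim).const_mul (d ^ (2 * s))).congr fun ε => ?_
    rw [← integral_indicator measurableSet_ball.compl, key' ε, integral_const_mul]
    set F := (ball x (d * ε))ᶜ.indicator
          (fun y => (v x - v y) / ‖x - y‖ ^ ((N : ℝ) + 2 * s)) with hF
    -- The kernel gives `d ^ (N + 2s)`, the change of variables `d ^ (-N)`.
    rw [Measure.integral_comp_smul volume (fun z => F (x + z)) d,
      integral_add_left_eq_self F x, hF, integral_indicator measurableSet_ball.compl,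
      finrank_euclideanSpace_fin, smul_eq_mul, ← mul_assoc, abs_of_pos (by positivity),
      Real.rpow_add hd, Real.rpow_natCast]
    have : d ^ N ≠ 0 := by positivity
    simp only [Function.comp]
    field_simp

/-- Upper bound for the fractional Laplacian at the origin from a one-sided bound on increments.
The odd linear term does not contribute. -/
theorem HasFracLaplacianAt.le_of_increment_le {N : ℕ} (hN : 1 ≤ N) {s : ℝ} (hs0 : 0 < s)
    (hs1 : s < 1) {w : EuclideanSpace ℝ (Fin N) → ℝ} {L : ℝ} (h : HasFracLaplacianAt s w 0 L)
    {A m : ℝ} (hA : 0 ≤ A) (p : EuclideanSpace ℝ (Fin N)) {B : Set (EuclideanSpace ℝ (Fin N))}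
    (hB : MeasurableSet B) (hB1 : B ⊆ (ball 0 1)ᶜ)
    (hw : ∀ z, w 0 - w z ≤ A * min 1 (‖z‖ ^ 2) + (ball 0 1).indicator (fun z => inner ℝ z p) z
      - m * B.indicator 1 z) :
    L ≤ A * (∫ z : EuclideanSpace ℝ (Fin N), min 1 (‖z‖ ^ 2) / ‖z‖ ^ ((N : ℝ) + 2 * s))
      - m * ∫ z in B, (‖z‖ ^ ((N : ℝ) + 2 * s))⁻¹ := by
  refine le_of_tendsto h.2 ?_
  filter_upwards [Ioo_mem_nhdsGT (zero_lt_one (α := ℝ))] with ε hε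
  obtain ⟨hε0, hε1⟩ := hε
  have hK := integrable_min_one_sq_div_norm_rpow hN hs0 hs1
  set q : ℝ := (N : ℝ) + 2 * s with hq
  have hmeas : MeasurableSet (ball (0 : EuclideanSpace ℝ (Fin N)) ε)ᶜ := measurableSet_ball.compl
  have hodd_meas : Measurable fun z : EuclideanSpace ℝ (Fin N) => inner ℝ z p / ‖z‖ ^ q := by
    fun_prop
  set S : Set (EuclideanSpace ℝ (Fin N)) := (ball 0 ε)ᶜ with hS
  have hodd : Integrable (fun z : EuclideanSpace ℝ (Fin N) =>
      (ball 0 1 ∩ S).indicator (fun z => inner ℝ z p / ‖z‖ ^ q) z) := by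
    refine (hK.const_mul (‖p‖ / ε)).mono'
      (hodd_meas.indicator (measurableSet_ball.inter hmeas)).aestronglyMeasurable
      (Eventually.of_forall fun z => ?_)
    by_cases hz : z ∈ ball 0 1 ∩ S
    · rw [indicator_of_mem hz, norm_div, Real.norm_of_nonneg (by positivity : 0 ≤ ‖z‖ ^ q),
        mul_div_assoc']
      gcongr
      have h1 : ‖z‖ < 1 := by simpa using hz.1
      have h2 : ε ≤ ‖z‖ := by simpa [hS] using hz.2
      rw [min_eq_right (by nlinarith [norm_nonneg z])]
      calc ‖inner ℝ z p‖ ≤ ‖z‖ * ‖p‖ := norm_inner_le_norm z p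
        _ = ‖p‖ / ε * (ε * ‖z‖) := by field_simp
        _ ≤ ‖p‖ / ε * ‖z‖ ^ 2 := by
          gcongr
          nlinarith
    · rw [indicator_of_notMem hz, norm_zero]
      positivity
  have hodd0 : ∫ z : EuclideanSpace ℝ (Fin N),
      (ball 0 1 ∩ S).indicator (fun z => inner ℝ z p / ‖z‖ ^ q) z = 0 := by
    have h1 := integral_neg_eq_self (fun z : EuclideanSpace ℝ (Fin N) =>
      (ball 0 1 ∩ S).indicator (fun z => inner ℝ z p / ‖z‖ ^ q) z) volume
    have h2 : ∀ z : EuclideanSpace ℝ (Fin N),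
        (ball 0 1 ∩ S).indicator (fun z => inner ℝ z p / ‖z‖ ^ q) (-z)
          = -(ball 0 1 ∩ S).indicator (fun z => inner ℝ z p / ‖z‖ ^ q) z := by
      intro z
      have : -z ∈ ball 0 1 ∩ S ↔ z ∈ ball 0 1 ∩ S := by simp [hS]
      by_cases hz : z ∈ ball 0 1 ∩ S
      · rw [indicator_of_mem hz, indicator_of_mem (this.2 hz), inner_neg_left, norm_neg, neg_div]
      · rw [indicator_of_notMem hz, indicator_of_notMem (fun h => hz (this.1 h)), neg_zero]
    simp only [h2, integral_neg] at h1
    linarith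
  have hBint := (integrable_indicator_iff hB).2 (integrableOn_inv_norm_rpow hN hs0 hs1 hB hB1)
  have hsum : Integrable fun z : EuclideanSpace ℝ (Fin N) => A * (min 1 (‖z‖ ^ 2) / ‖z‖ ^ q)
      + (ball 0 1 ∩ S).indicator (fun z => inner ℝ z p / ‖z‖ ^ q) z := (hK.const_mul A).add hodd
  have hle : ∀ z, S.indicator (fun y => (w 0 - w y) / ‖0 - y‖ ^ q) z
      ≤ A * (min 1 (‖z‖ ^ 2) / ‖z‖ ^ q)
        + (ball 0 1 ∩ S).indicator (fun z => inner ℝ z p / ‖z‖ ^ q) z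
        - m * B.indicator (fun z => (‖z‖ ^ q)⁻¹) z := by
    intro z
    by_cases hz : z ∈ S
    · rw [indicator_of_mem hz, zero_sub, norm_neg]
      calc (w 0 - w z) / ‖z‖ ^ q
          ≤ (A * min 1 (‖z‖ ^ 2) + (ball 0 1).indicator (fun z => inner ℝ z p) z
            - m * B.indicator 1 z) / ‖z‖ ^ q := by
            exact div_le_div_of_nonneg_right (hw z) (by positivity)
        _ = _ := by
          by_cases hz1 : z ∈ ball 0 1 <;> by_cases hzB : z ∈ B <;>
            simp only [indicator, mem_inter_iff, hz1, hzB, hz, and_true, if_true, if_false,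
              Pi.one_apply] <;> ring
    · have hzB : z ∉ B := fun h' => hz fun hz' => hB1 h' (ball_subset_ball hε1.le hz')
      rw [indicator_of_notMem hz, indicator_of_notMem (fun h' => hz h'.2),
        indicator_of_notMem hzB]
      have : 0 ≤ A * (min 1 (‖z‖ ^ 2) / ‖z‖ ^ q) := by positivity
      linarith
  calc ∫ y in S, (w 0 - w y) / ‖0 - y‖ ^ q
      = ∫ z, S.indicator (fun y => (w 0 - w y) / ‖0 - y‖ ^ q) z :=
        (integral_indicator hmeas).symm
    _ ≤ ∫ z, (A * (min 1 (‖z‖ ^ 2) / ‖z‖ ^ q)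
        + (ball 0 1 ∩ S).indicator (fun z => inner ℝ z p / ‖z‖ ^ q) z
        - m * B.indicator (fun z => (‖z‖ ^ q)⁻¹) z) :=
        integral_mono ((integrable_indicator_iff hmeas).2 (h.1 ε hε0))
          (hsum.sub (hBint.const_mul m)) hle
    _ = _ := by
        rw [integral_sub hsum (hBint.const_mul m),
          integral_add (hK.const_mul A) hodd, hodd0, integral_const_mul, integral_const_mul,
          integral_indicator hB, add_zero]

/-! ### Touching paraboloids -/

/-- A function that almost attains its lower bound `-m` at `x₀` is touched from below, at some
point of the ball of radius `d` around `x₀`, by a paraboloid of opening of order `η / d²`. -/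
theorem exists_touching_paraboloid {N : ℕ} {u : EuclideanSpace ℝ (Fin N) → ℝ} (hu : Continuous u)
    {m η d : ℝ} (hη : 0 < η) (hd : 0 < d) (hm : ∀ y, -m ≤ u y) {x₀ : EuclideanSpace ℝ (Fin N)}
    (hx₀ : u x₀ ≤ -m + η) :
    ∃ x₁, ‖x₁ - x₀‖ ≤ d ∧ u x₁ ≤ -m + η ∧
      ∀ y, u x₁ - u y ≤ 2 * η / d ^ 2 * (2 * inner ℝ (y - x₁) (x₁ - x₀) + ‖y - x₁‖ ^ 2) := by
  set b : ℝ := 2 * η / d ^ 2 with hb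
  have hb0 : 0 < b := by positivity
  have hbd : b * d ^ 2 = 2 * η := by rw [hb]; field_simp
  obtain ⟨x₁, hx₁, hmin⟩ := (isCompact_closedBall x₀ d).exists_isMinOn
    ⟨x₀, mem_closedBall_self hd.le⟩
    (f := fun y => u y + b * ‖y - x₀‖ ^ 2) (by fun_prop)
  have hx₁d : ‖x₁ - x₀‖ ≤ d := by simpa [dist_eq_norm] using hx₁
  have h0 : u x₁ + b * ‖x₁ - x₀‖ ^ 2 ≤ u x₀ := by
    simpa using hmin (mem_closedBall_self hd.le)
  refine ⟨x₁, hx₁d, ?_, fun y => ?_⟩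
  · have : 0 ≤ b * ‖x₁ - x₀‖ ^ 2 := by positivity
    linarith
  · have hall : u x₁ + b * ‖x₁ - x₀‖ ^ 2 ≤ u y + b * ‖y - x₀‖ ^ 2 := by
      by_cases hy : y ∈ closedBall x₀ d
      · exact hmin hy
      -- Outside the ball the penalty exceeds `b * d ^ 2 = 2η`, more than the gap `η` between `u x₀`
      -- and `-m`, so the minimum is global.
      · have hy' : d < ‖y - x₀‖ := by simpa [dist_eq_norm] using hy
        have : b * d ^ 2 ≤ b * ‖y - x₀‖ ^ 2 := by gcongr
        linarith [hm y]
    have hexp : ‖y - x₀‖ ^ 2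
        = ‖y - x₁‖ ^ 2 + 2 * inner ℝ (y - x₁) (x₁ - x₀) + ‖x₁ - x₀‖ ^ 2 := by
      rw [← norm_add_sq_real, sub_add_sub_cancel]
    rw [hexp] at hall
    linarith

open Classical in
/-- At a point touched from below by a paraboloid as in `exists_touching_paraboloid`, a viscosity
supersolution that is nonnegative on `x₁ + d • B` satisfies a balance between the opening `η` and
the lower bound `-m`. -/
theorem IsViscositySupersolution.balance_of_touching_paraboloid {N : ℕ} (hN : 1 ≤ N) {s : ℝ}
    (hs0 : 0 < s) (hs1 : s < 1) {D : Set (EuclideanSpace ℝ (Fin N))} (hDopen : IsOpen D)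
    {u : EuclideanSpace ℝ (Fin N) → ℝ} (hsuper : IsViscositySupersolution s D u)
    {m η d : ℝ} (hη : 0 < η) (hd : 0 < d) (hm : ∀ y, -m ≤ u y) {x₁ e : EuclideanSpace ℝ (Fin N)}
    (hx₁ : x₁ ∈ D) (hux₁ : u x₁ ≤ -m + η)
    (htouch : ∀ y, u x₁ - u y ≤ 2 * η / d ^ 2 * (2 * inner ℝ (y - x₁) e + ‖y - x₁‖ ^ 2))
    {B : Set (EuclideanSpace ℝ (Fin N))} (hB : MeasurableSet B) (hB1 : B ⊆ (ball 0 1)ᶜ)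
    (huB : ∀ z ∈ B, 0 ≤ u (x₁ + d • z)) :
    0 ≤ 4 * η * (∫ z : EuclideanSpace ℝ (Fin N), min 1 (‖z‖ ^ 2) / ‖z‖ ^ ((N : ℝ) + 2 * s))
      - m * ∫ z in B, (‖z‖ ^ ((N : ℝ) + 2 * s))⁻¹ := by
  obtain ⟨r₀, hr₀, hr₀D⟩ := Metric.isOpen_iff.1 hDopen x₁ hx₁
  -- `r ≤ d` keeps the modified region inside the unit ball after rescaling.
  set r := min r₀ d with hr
  have hr0 : 0 < r := lt_min hr₀ hd
  set b : ℝ := 2 * η / d ^ 2 with hb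
  have hb0 : 0 < b := by positivity
  have hbd : b * d ^ 2 = 2 * η := by rw [hb]; field_simp
  -- Doubling the quadratic term of the paraboloid makes the contact strict; hence `A = 4η = 2 * b *
  -- d ^ 2` below.
  set φ : EuclideanSpace ℝ (Fin N) → ℝ :=
    fun y => u x₁ - b * (2 * inner ℝ (y - x₁) e + 2 * ‖y - x₁‖ ^ 2) with hφ
  have hφs : ContDiff ℝ ∞ φ := by
    refine contDiff_const.sub (contDiff_const.mul ((contDiff_const.mul ?_).add
      (contDiff_const.mul ?_)))
    · exact (contDiff_id.sub contDiff_const).inner ℝ contDiff_const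
    · exact (contDiff_id.sub contDiff_const).norm_sq ℝ
  have hφ1 : φ x₁ = u x₁ := by simp [hφ]
  obtain ⟨L, hL, hL0⟩ := hsuper x₁ hx₁ (ball x₁ r) isOpen_ball (mem_ball_self hr0)
    ((ball_subset_ball (min_le_left _ _)).trans hr₀D) isBounded_ball φ hφs hφ1 (by
      intro y _ hy
      have h1 := htouch y
      have h2 : 0 < ‖y - x₁‖ := norm_pos_iff.2 (sub_ne_zero.2 hy)
      have h3 : 0 < b * ‖y - x₁‖ ^ 2 := by positivity
      simp only [hφ]
      linarith)
  have hscaled := (hL.comp_add_smul hd).le_of_increment_le hN hs0 hs1 (A := 4 * η) (m := m)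
    (by positivity) ((2 * b * d) • e) hB hB1 (by
      intro z
      have hx1 : (ball x₁ r).piecewise φ u (x₁ + d • 0) = u x₁ := by
        rw [smul_zero, add_zero, piecewise_eq_of_mem _ _ _ (mem_ball_self hr0), hφ1]
      rw [hx1]
      have hnorm : ‖d • z‖ = d * ‖z‖ := by rw [norm_smul, Real.norm_of_nonneg hd.le]
      by_cases hz : z ∈ ball 0 1
      · have hz1 : ‖z‖ < 1 := by simpa using hz
        have hzB : z ∉ B := fun h => hB1 h hz
        rw [indicator_of_mem hz, indicator_of_notMem hzB,
          min_eq_right (by nlinarith [norm_nonneg z]), inner_smul_right]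
        have hq : b * (2 * inner ℝ (d • z) e + 2 * ‖d • z‖ ^ 2)
            = 4 * η * ‖z‖ ^ 2 + 2 * b * d * inner ℝ z e := by
          rw [hnorm, real_inner_smul_left]
          linear_combination 2 * ‖z‖ ^ 2 * hbd
        by_cases hzU : x₁ + d • z ∈ ball x₁ r
        · rw [piecewise_eq_of_mem _ _ _ hzU]
          simp only [hφ, add_sub_cancel_left]
          linarith
        · rw [piecewise_eq_of_notMem _ _ _ hzU]
          have h1 := htouch (x₁ + d • z)
          rw [add_sub_cancel_left] at h1
          have h2 : 0 ≤ b * ‖d • z‖ ^ 2 := by positivity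
          linarith
      · have hz1 : 1 ≤ ‖z‖ := by simpa using hz
        have hzU : x₁ + d • z ∉ ball x₁ r := by
          rw [mem_ball, dist_eq_norm, add_sub_cancel_left, hnorm, not_lt]
          exact (min_le_right _ _).trans (le_mul_of_one_le_right hd.le hz1)
        rw [piecewise_eq_of_notMem _ _ _ hzU, indicator_of_notMem hz,
          min_eq_left (by nlinarith)]
        by_cases hzB : z ∈ B
        · rw [indicator_of_mem hzB, Pi.one_apply]
          linarith [huB z hzB]
        · rw [indicator_of_notMem hzB]
          linarith [hm (x₁ + d • z)])
  exact (mul_nonneg (Real.rpow_nonneg hd.le _) hL0).trans hscaled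

/-! ### The maximum principle -/

theorem lemma2p1 (N : ℕ) (hN : 2 ≤ N) (s : ℝ) (hs0 : 0 < s) (hs1 : s < 1)
    (D : Set (EuclideanSpace ℝ (Fin N))) (hDopen : IsOpen D) (hDconn : IsConnected D)
    (hD : D ⊆ halfSpace N)
    (u : EuclideanSpace ℝ (Fin N) → ℝ) (hu : Continuous u) (hbdd : ∃ C : ℝ, ∀ x, |u x| ≤ C)
    (hsuper : IsViscositySupersolution s D u) (hout : ∀ x, x ∉ D → 0 ≤ u x) :
    ∀ x ∈ D, 0 ≤ u x := by
  by_contra! hneg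
  obtain ⟨x, -, hx⟩ := hneg
  obtain ⟨C, hC⟩ := hbdd
  have hbelow : BddBelow (range u) := ⟨-C, by rintro _ ⟨y, rfl⟩; exact (abs_le.1 (hC y)).1⟩
  obtain ⟨m, hm_def⟩ : ∃ m, m = -sInf (range u) := ⟨_, rfl⟩
  have hm : ∀ y, -m ≤ u y := fun y => by
    rw [hm_def, neg_neg]
    exact csInf_le hbelow (mem_range_self y)
  have hm0 : 0 < m := by linarith [hm x]
  have hN1 : 1 ≤ N := by omega
  let i : Fin N := ⟨N - 1, by omega⟩
  have hi : (i : ℕ) + 1 = N := Nat.sub_add_cancel hN1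
  -- The last coordinate of `x₁` is at most `2d`, so for `z` in the unit ball about `p` that of `x₁
  -- + d • z` is below `2d - 3d < 0`.
  let p : EuclideanSpace ℝ (Fin N) := EuclideanSpace.single i (-4)
  have hball : ∀ z ∈ ball p 1, z i < -3 := fun z hz => by
    have h1 : ‖z - p‖ < 1 := by simpa [dist_eq_norm] using hz
    have h2 := (abs_le.1 ((Real.norm_eq_abs _).symm.trans_le (PiLp.norm_apply_le (z - p) i))).2
    have h3 : (z - p) i = z i + 4 := by simp [p]
    linarith
  have hB1 : ball p 1 ⊆ (ball 0 1)ᶜ := fun z hz hz0 => by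
    have h1 : ‖z‖ < 1 := by simpa using hz0
    have h2 := (abs_le.1 ((Real.norm_eq_abs _).symm.trans_le (PiLp.norm_apply_le z i))).1
    linarith [hball z hz]
  have hc := setIntegral_inv_norm_rpow_pos hN1 hs0 hs1 one_pos hB1
  have hk : 0 ≤ ∫ z : EuclideanSpace ℝ (Fin N), min 1 (‖z‖ ^ 2) / ‖z‖ ^ ((N : ℝ) + 2 * s) :=
    integral_nonneg fun z => by positivity
  have hmain := fun (η d : ℝ) (hη : 0 < η) (hd : 0 < d) (x₁ e : EuclideanSpace ℝ (Fin N))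
    (hx₁ : x₁ ∈ D) (h₁ : u x₁ ≤ -m + η) h₂ h₃ =>
    hsuper.balance_of_touching_paraboloid hN1 hs0 hs1 hDopen hη hd hm (e := e) hx₁ h₁ h₂
      measurableSet_ball hB1 h₃
  set c := ∫ z in ball p 1, (‖z‖ ^ ((N : ℝ) + 2 * s))⁻¹
  set k := ∫ z : EuclideanSpace ℝ (Fin N), min 1 (‖z‖ ^ 2) / ‖z‖ ^ ((N : ℝ) + 2 * s)
  -- `δ < 1` forces near-minimum points into `D`; `4δk < c` makes the final balance negative.
  obtain ⟨δ, hδ0, hδ1, hδ⟩ : ∃ δ : ℝ, 0 < δ ∧ δ < 1 ∧ 4 * δ * k < c := by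
    refine ⟨min (1 / 2) (c / (8 * (k + 1))), by positivity,
      (min_le_left _ _).trans_lt (by norm_num), ?_⟩
    calc 4 * min (1 / 2) (c / (8 * (k + 1))) * k ≤ 4 * (c / (8 * (k + 1))) * k := by
          gcongr
          exact min_le_right _ _
      _ = c / 2 * (k / (k + 1)) := by field_simp; ring
      _ ≤ c / 2 * 1 := by
          gcongr
          exact (div_le_one (by positivity)).2 (by linarith)
      _ < c := by linarith
  have hneg_mem : ∀ y, u y ≤ -m + δ * m → y ∈ D := fun y hy => by
    by_contra hyD
    nlinarith [hout y hyD]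
  obtain ⟨_, ⟨x₀, rfl⟩, hx₀⟩ := exists_lt_of_csInf_lt (range_nonempty u)
    (show sInf (range u) < -m + δ * m by nlinarith)
  have hd : 0 < x₀ i := hD (hneg_mem x₀ hx₀.le) i hi
  obtain ⟨x₁, hx₁d, hux₁, htouch⟩ :=
    exists_touching_paraboloid hu (mul_pos hδ0 hm0) hd hm hx₀.le
  have hfin := hmain (δ * m) (x₀ i) (mul_pos hδ0 hm0) hd x₁ _ (hneg_mem x₁ hux₁) hux₁ htouch
    fun z hz => by
      refine hout _ fun hmem => ?_
      have h1 := hD hmem i hi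
      have h2 := (abs_le.1 ((Real.norm_eq_abs _).symm.trans_le
        (PiLp.norm_apply_le (x₁ - x₀) i))).2
      have h3 := hball z hz
      simp only [PiLp.add_apply, PiLp.smul_apply, PiLp.sub_apply, smul_eq_mul] at h1 h2
      nlinarith
  nlinarith
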